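/- Let $G$ be an abelian lattice ordered group with identity $e$ and positive cone $P=\{g\in G: g\ge e\}$, let $A$ be a $C^*$-algebra (not necessarily unital), and let $\alpha:P\to\operatorname{End}(A)$, $p\mapsto\alpha_p$, be a unital semigroup homomorphism into the $*$-endomorphisms of $A$. A \emph{covariant pair} $(\pi,T)$ consists of a $*$-representation $\pi:A\to B(H)$ and a unital semigroup homomorphism $T:P\to B(H)$ into the contractions of a Hilbert space $H$ such that $\pi(a)T(s)=T(s)\pi(\alpha_s(a))$ for all $a\in A$, $s\in P$. It is \emph{Nica-covariant} if $T(s)T(t)^*=T(t)^*T(s)$ whenever $s\wedge t=e$, and \emph{isometric} if every $T(s)$ is an isometry. Let $\mathcal P(A,P)$ be the algebra of formal polynomials $\sum_{i=1}^n e_{p_i}a_{p_i}$ ($p_i\in P$, $a_{p_i}\in A$), with multiplication determined by $(e_pa)(e_qb)=e_{pq}\,\alpha_q(a)b$. For a covariant pair put $(\pi\times T)\big(\sum_i e_{p_i}a_{p_i}\big)=\sum_i T(p_i)\pi(a_{p_i})$. For a family $\mathcal F$ of covariant pairs let $\|q\|_{\mathcal F}=\sup\{\|(\pi\times T)(q)\|:(\pi,T)\in\mathcal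 F\}$, and let $A\times_\alpha^{\mathcal F}P$ be the Banach algebra obtained as the completion of $\mathcal P(A,P)$ with respect to $\|\cdot\|_{\mathcal F}$. Write $A\times_\alpha^{nc}P$ for the algebra given by the family of all Nica-covariant pairs, and $A\times_\alpha^{nc,iso}P$ for the one given by the family of all isometric Nica-covariant pairs. Then $A\times_\alpha^{nc}P\cong A\times_\alpha^{nc,iso}P$: there is a surjective linear isometry $\Phi:A\times_\alpha^{nc}P\to A\times_\alpha^{nc,iso}P$ that is multiplicative and satisfies $\Phi(q)=q$ for every $q\in\mathcal P(A,P)$ (where $q$ also denotes its canonical image in either completion). -/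

import Mathlib

universe u v w

noncomputable section

namespace Semicrossed

section Polynomials

variable {P : Type v} [CommMonoid P] {A : Type u} [NonUnitalCStarAlgebra A]

/-- The algebra `𝒫(A, P)` of formal polynomials `∑ e_p a_p` (finite sums, `p ∈ P`, `a_p ∈ A`) of the
C⋆-dynamical system `(A, α, P)`; the polynomial `∑ e_p a_p` is the finitely supported function
`p ↦ a_p`. -/
@[nolint unusedArguments]
def Poly (_α : P →* (A →⋆ₙₐ[ℂ] A)) : Type (max u v) := P →₀ A

variable (α : P →* (A →⋆ₙₐ[ℂ] A))

namespace Poly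

instance : AddCommGroup (Poly α) := inferInstanceAs (AddCommGroup (P →₀ A))

instance : Module ℂ (Poly α) := inferInstanceAs (Module ℂ (P →₀ A))

/-- The coefficients `p ↦ a_p` of the polynomial `∑ e_p a_p`. -/
def coeff {α : P →* (A →⋆ₙₐ[ℂ] A)} (f : Poly α) : P →₀ A := f

/-- The monomial `e_p a`. -/
def monomial (p : P) : A →+ Poly α := Finsupp.singleAddHom p

/-- The multiplication of polynomials, determined by the rules `a e_s = e_s α_s(a)` and
`e_p e_q = e_{pq}`, that is by `(e_p a) (e_q b) = e_{pq} (α_q(a) b)`. -/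
instance : Mul (Poly α) where
  mul f g := f.coeff.sum fun p a => g.coeff.sum fun q b => monomial α (p * q) (α q a * b)

variable {α}

theorem addHom_ext {M : Type*} [AddZeroClass M] {f g : Poly α →+ M}
    (h : ∀ p a, f (monomial α p a) = g (monomial α p a)) : f = g :=
  Finsupp.addHom_ext (f := f) (g := g) h

theorem coeff_zero : (0 : Poly α).coeff = 0 := rfl

theorem coeff_add (f g : Poly α) : (f + g).coeff = f.coeff + g.coeff := rfl

theorem coeff_monomial (p : P) (a : A) : (monomial α p a).coeff = Finsupp.single p a := rfl

theorem mul_def (f g : Poly α) :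
    f * g = f.coeff.sum fun p a => g.coeff.sum fun q b => monomial α (p * q) (α q a * b) := rfl

theorem add_mul' (f g h : Poly α) : (f + g) * h = f * h + g * h := by
  classical
  simp only [mul_def, coeff_add]
  refine Finsupp.sum_add_index' (fun p => ?_) (fun p a b => ?_)
  · simp [Finsupp.sum]
  · simp [Finsupp.sum, add_mul, Finset.sum_add_distrib]

theorem mul_add' (f g h : Poly α) : f * (g + h) = f * g + f * h := by
  classical
  simp only [mul_def, coeff_add]
  rw [← Finsupp.sum_add]
  refine Finsupp.sum_congr fun p _ => ?_
  refine Finsupp.sum_add_index' (fun q => ?_) (fun q a b => ?_)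
  · simp
  · simp [mul_add]

instance : NonUnitalNonAssocRing (Poly α) where
  left_distrib := mul_add'
  right_distrib := add_mul'
  zero_mul f := by
    have := add_mul' 0 0 f
    simpa using this
  mul_zero f := by
    have := mul_add' f 0 0
    simpa using this

theorem monomial_mul_monomial (p q : P) (a b : A) :
    monomial α p a * monomial α q b = monomial α (p * q) (α q a * b) := by
  rw [mul_def, coeff_monomial, coeff_monomial, Finsupp.sum_single_index, Finsupp.sum_single_index]
  · simp
  · simp [Finsupp.sum]

instance : NonUnitalRing (Poly α) where
  mul_assoc f g h := by
    have : (AddMonoidHom.mulLeft₃ : Poly α →+ Poly α →+ Poly α →+ Poly α) =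
        AddMonoidHom.mulRight₃ := by
      refine addHom_ext fun p a => addHom_ext fun q b => addHom_ext fun r c => ?_
      simp only [AddMonoidHom.mulLeft₃_apply, AddMonoidHom.mulRight₃_apply,
        monomial_mul_monomial, map_mul, mul_assoc]
      have hc : α q * α r = α r * α q := by rw [← map_mul, mul_comm, map_mul]
      rw [hc]
      rfl
    exact DFunLike.congr_fun (DFunLike.congr_fun (DFunLike.congr_fun this f) g) h

theorem smul_monomial (c : ℂ) (p : P) (a : A) : c • monomial α p a = monomial α p (c • a) :=
  Finsupp.smul_single c p a

instance : IsScalarTower ℂ (Poly α) (Poly α) where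
  smul_assoc c f g := by
    have : (AddMonoidHom.mul.comp (DistribSMul.toAddMonoidHom (Poly α) c) :
        Poly α →+ Poly α →+ Poly α) =
        (AddMonoidHom.compHom (DistribSMul.toAddMonoidHom (Poly α) c)).comp AddMonoidHom.mul := by
      refine addHom_ext fun p a => addHom_ext fun q b => ?_
      simp [smul_monomial, monomial_mul_monomial, smul_mul_assoc]
    exact DFunLike.congr_fun (DFunLike.congr_fun this f) g

instance : SMulCommClass ℂ (Poly α) (Poly α) where
  smul_comm c f g := by
    have : ((AddMonoidHom.compHom (DistribSMul.toAddMonoidHom (Poly α) c)).comp AddMonoidHom.mul :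
        Poly α →+ Poly α →+ Poly α) =
        (AddMonoidHom.compHom.flip (DistribSMul.toAddMonoidHom (Poly α) c)).comp
          AddMonoidHom.mul := by
      refine addHom_ext fun p a => addHom_ext fun q b => ?_
      simp [smul_monomial, monomial_mul_monomial, mul_smul_comm]
    exact DFunLike.congr_fun (DFunLike.congr_fun this f) g

end Poly

/-- A covariant pair `(π, T)` of the C⋆-dynamical system `(A, α, P)` on a Hilbert space `H`: a
`*`-representation `π` of `A` (possibly degenerate) and a contractive representation `T` of `P` with
`π(a) T(s) = T(s) π(α_s(a))`. -/
structure CovariantPair where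
  /-- The Hilbert space. -/
  H : Type (max u v w)
  [instNormed : NormedAddCommGroup H]
  [instInner : InnerProductSpace ℂ H]
  [instComplete : CompleteSpace H]
  /-- The representation of the C⋆-algebra. -/
  π : A →⋆ₙₐ[ℂ] (H →L[ℂ] H)
  /-- The representation of the semigroup. -/
  T : P →* (H →L[ℂ] H)
  contractive : ∀ p, ‖T p‖ ≤ 1
  covariant : ∀ (s : P) (a : A), π a * T s = T s * π (α s a)

attribute [instance] CovariantPair.instNormed CovariantPair.instInner CovariantPair.instComplete

variable {α}

namespace CovariantPair

/-- The representation `π × T` of `𝒫(A, P)`: `(π × T)(∑ e_p a_p) = ∑ T(p) π(a_p)`. -/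
def eval (X : CovariantPair.{u, v, w} α) (q : Poly α) : X.H →L[ℂ] X.H :=
  q.coeff.sum fun p a => X.T p * X.π a

variable (X : CovariantPair.{u, v, w} α)

theorem eval_monomial (p : P) (a : A) : X.eval (Poly.monomial α p a) = X.T p * X.π a :=
  Finsupp.sum_single_index (h := fun p a => X.T p * X.π a) (by simp)

theorem eval_zero : X.eval 0 = 0 :=
  Finsupp.sum_zero_index (h := fun p a => X.T p * X.π a)

theorem eval_add (f g : Poly α) : X.eval (f + g) = X.eval f + X.eval g := by
  classical
  exact Finsupp.sum_add_index' (h := fun p a => X.T p * X.π a) (by simp) (by simp [mul_add])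

/-- `eval` as an additive map. -/
def evalHom : Poly α →+ (X.H →L[ℂ] X.H) where
  toFun := X.eval
  map_zero' := X.eval_zero
  map_add' := X.eval_add

theorem eval_neg (f : Poly α) : X.eval (-f) = -X.eval f := map_neg X.evalHom f

theorem eval_smul (c : ℂ) (f : Poly α) : X.eval (c • f) = c • X.eval f := by
  have : X.evalHom.comp (DistribSMul.toAddMonoidHom (Poly α) c) =
      (DistribSMul.toAddMonoidHom (X.H →L[ℂ] X.H) c).comp X.evalHom := by
    refine Poly.addHom_ext fun p a => ?_
    simp [evalHom, Poly.smul_monomial, eval_monomial]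
  exact DFunLike.congr_fun this f

theorem eval_mul (f g : Poly α) : X.eval (f * g) = X.eval f * X.eval g := by
  have : (AddMonoidHom.compHom X.evalHom).comp AddMonoidHom.mul =
      (AddMonoidHom.compHom.flip X.evalHom).comp (AddMonoidHom.mul.comp X.evalHom) := by
    refine Poly.addHom_ext fun p a => Poly.addHom_ext fun q b => ?_
    simp only [evalHom, AddMonoidHom.coe_comp, Function.comp_apply, AddMonoidHom.compHom_apply_apply,
      AddMonoidHom.flip_apply, AddMonoidHom.coe_mul, AddMonoidHom.coe_mk, ZeroHom.coe_mk,
      AddMonoidHom.coe_mulLeft, Poly.monomial_mul_monomial, eval_monomial, map_mul]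
    rw [mul_assoc (X.T p) (X.π a), ← mul_assoc (X.π a), X.covariant]
    simp only [mul_assoc]
  exact DFunLike.congr_fun (DFunLike.congr_fun this f) g

theorem norm_eval_le (q : Poly α) : ‖X.eval q‖ ≤ q.coeff.sum fun _ a => ‖a‖ := by
  refine (norm_sum_le _ _).trans (Finset.sum_le_sum fun p _ => ?_)
  refine (norm_mul_le _ _).trans ?_
  calc ‖X.T p‖ * ‖X.π (q.coeff p)‖ ≤ 1 * ‖q.coeff p‖ :=
        mul_le_mul (X.contractive p) (NonUnitalStarAlgHom.norm_apply_le X.π _) (norm_nonneg _)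
          zero_le_one
    _ = ‖q.coeff p‖ := one_mul _

end CovariantPair

/-- The seminorm `‖q‖_𝓕 = sup {‖(π × T)(q)‖ : (π, T) ∈ 𝓕}` on `𝒫(A, P)`. -/
def familyNorm (𝓕 : Set (CovariantPair.{u, v, w} α)) (q : Poly α) : ℝ :=
  ⨆ X : 𝓕, ‖X.1.eval q‖

section FamilyNorm

variable (𝓕 : Set (CovariantPair.{u, v, w} α))

theorem bddAbove_family (q : Poly α) :
    BddAbove (Set.range fun X : 𝓕 => ‖X.1.eval q‖) :=
  ⟨_, by rintro _ ⟨X, rfl⟩; exact X.1.norm_eval_le q⟩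

theorem le_familyNorm (X : 𝓕) (q : Poly α) : ‖X.1.eval q‖ ≤ familyNorm 𝓕 q :=
  le_ciSup (bddAbove_family 𝓕 q) X

theorem familyNorm_nonneg (q : Poly α) : 0 ≤ familyNorm 𝓕 q :=
  Real.iSup_nonneg fun _ => norm_nonneg _

theorem familyNorm_le {q : Poly α} {r : ℝ} (hr : 0 ≤ r) (h : ∀ X ∈ 𝓕, ‖X.eval q‖ ≤ r) :
    familyNorm 𝓕 q ≤ r :=
  Real.iSup_le (fun X => h X.1 X.2) hr

/-- The algebra `𝒫(A, P)`, equipped with the seminorm `‖·‖_𝓕`. -/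
@[nolint unusedArguments]
def NormedPoly (_𝓕 : Set (CovariantPair.{u, v, w} α)) : Type (max u v) := Poly α

namespace NormedPoly

instance : NonUnitalRing (NormedPoly 𝓕) := inferInstanceAs (NonUnitalRing (Poly α))

instance : Module ℂ (NormedPoly 𝓕) := inferInstanceAs (Module ℂ (Poly α))

instance : IsScalarTower ℂ (NormedPoly 𝓕) (NormedPoly 𝓕) :=
  inferInstanceAs (IsScalarTower ℂ (Poly α) (Poly α))

instance : SMulCommClass ℂ (NormedPoly 𝓕) (NormedPoly 𝓕) :=
  inferInstanceAs (SMulCommClass ℂ (Poly α) (Poly α))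

/-- `‖·‖_𝓕` as a seminorm on the additive group of polynomials. -/
def groupSeminorm : AddGroupSeminorm (NormedPoly 𝓕) where
  toFun q := familyNorm 𝓕 q
  map_zero' := le_antisymm
    (familyNorm_le 𝓕 le_rfl fun X _ => (congrArg norm X.eval_zero).le.trans norm_zero.le)
    (familyNorm_nonneg 𝓕 _)
  add_le' f g := familyNorm_le 𝓕 (add_nonneg (familyNorm_nonneg 𝓕 _) (familyNorm_nonneg 𝓕 _))
    fun X hX => (congrArg norm (X.eval_add f g)).le.trans <| (norm_add_le _ _).trans <|
      add_le_add (le_familyNorm 𝓕 ⟨X, hX⟩ f) (le_familyNorm 𝓕 ⟨X, hX⟩ g)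
  neg' f := iSup_congr fun X => (congrArg norm (X.1.eval_neg f)).trans (norm_neg _)

instance : SeminormedAddCommGroup (NormedPoly 𝓕) :=
  (groupSeminorm 𝓕).toSeminormedAddCommGroup

instance : NonUnitalSeminormedRing (NormedPoly 𝓕) where
  __ := (inferInstance : SeminormedAddCommGroup (NormedPoly 𝓕))
  __ := (inferInstance : NonUnitalRing (NormedPoly 𝓕))
  norm_mul_le f g := familyNorm_le 𝓕
    (mul_nonneg (familyNorm_nonneg 𝓕 _) (familyNorm_nonneg 𝓕 _))
    fun X hX => (congrArg norm (X.eval_mul f g)).le.trans <| (norm_mul_le _ _).trans <|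
      mul_le_mul (le_familyNorm 𝓕 ⟨X, hX⟩ f) (le_familyNorm 𝓕 ⟨X, hX⟩ g) (norm_nonneg _)
        (familyNorm_nonneg 𝓕 _)

instance : NormedSpace ℂ (NormedPoly 𝓕) where
  norm_smul_le c f := familyNorm_le 𝓕 (mul_nonneg (norm_nonneg c) (familyNorm_nonneg 𝓕 _))
    fun X hX => (congrArg norm (X.eval_smul c f)).le.trans <| (norm_smul_le _ _).trans <|
      mul_le_mul_of_nonneg_left (le_familyNorm 𝓕 ⟨X, hX⟩ f) (norm_nonneg c)

theorem norm_def (q : NormedPoly 𝓕) : ‖q‖ = ⨆ X : 𝓕, ‖X.1.eval q‖ := rfl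

end NormedPoly

/-- The semicrossed product `A ×_α^𝓕 P`: the (Hausdorff) completion of `𝒫(A, P)` with respect to
`‖·‖_𝓕`. -/
def SemicrossedProduct : Type (max u v) := UniformSpace.Completion (NormedPoly 𝓕)

namespace SemicrossedProduct

open UniformSpace UniformSpace.Completion

instance : NormedAddCommGroup (SemicrossedProduct 𝓕) :=
  inferInstanceAs (NormedAddCommGroup (Completion (NormedPoly 𝓕)))

instance : NormedSpace ℂ (SemicrossedProduct 𝓕) :=
  inferInstanceAs (NormedSpace ℂ (Completion (NormedPoly 𝓕)))

instance : CompleteSpace (SemicrossedProduct 𝓕) :=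
  inferInstanceAs (CompleteSpace (Completion (NormedPoly 𝓕)))

/-- The canonical map from `𝒫(A, P)` to the semicrossed product. -/
def ofPoly : Poly α →ₗ[ℂ] SemicrossedProduct 𝓕 :=
  (toComplₗᵢ : NormedPoly 𝓕 →ₗᵢ[ℂ] Completion (NormedPoly 𝓕)).toLinearMap

theorem norm_ofPoly (q : Poly α) : ‖ofPoly 𝓕 q‖ = familyNorm 𝓕 q :=
  (toComplₗᵢ : NormedPoly 𝓕 →ₗᵢ[ℂ] Completion (NormedPoly 𝓕)).norm_map q

theorem isDenseInducing_coe' :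
    IsDenseInducing ((↑) : NormedPoly 𝓕 → Completion (NormedPoly 𝓕)) := isDenseInducing_coe

theorem denseRange_ofPoly : DenseRange (ofPoly 𝓕) := (isDenseInducing_coe' 𝓕).dense

/-- The product on the semicrossed product: the continuous extension of the product of
polynomials. -/
instance : Mul (SemicrossedProduct 𝓕) where
  mul x y := ((isDenseInducing_coe' 𝓕).prodMap (isDenseInducing_coe' 𝓕)).extend
    (fun z : NormedPoly 𝓕 × NormedPoly 𝓕 => ((z.1 * z.2 : NormedPoly 𝓕) :
      Completion (NormedPoly 𝓕))) (x, y)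

theorem ofPoly_mul (f g : Poly α) : ofPoly 𝓕 (f * g) = ofPoly 𝓕 f * ofPoly 𝓕 g :=
  (((isDenseInducing_coe' 𝓕).prodMap (isDenseInducing_coe' 𝓕)).extend_eq
    ((continuous_coe (NormedPoly 𝓕)).comp continuous_mul) (f, g)).symm

instance : ContinuousMul (SemicrossedProduct 𝓕) where
  continuous_mul := by
    let m := (AddMonoidHom.mul : NormedPoly 𝓕 →+ NormedPoly 𝓕 →+ NormedPoly 𝓕).compr₂
      (toCompl : NormedPoly 𝓕 →+ Completion (NormedPoly 𝓕))
    have : Continuous fun p : NormedPoly 𝓕 × NormedPoly 𝓕 => m p.1 p.2 :=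
      (continuous_coe (NormedPoly 𝓕)).comp continuous_mul
    have di : IsDenseInducing (toCompl : NormedPoly 𝓕 → Completion (NormedPoly 𝓕)) :=
      isDenseInducing_coe
    exact (di.extend_Z_bilin di this :)

variable {𝓕}

@[elab_as_elim]
theorem ind {p : SemicrossedProduct 𝓕 → Prop} (x : SemicrossedProduct 𝓕)
    (hp : IsClosed {x | p x}) (h : ∀ q, p (ofPoly 𝓕 q)) : p x :=
  Completion.induction_on (α := NormedPoly 𝓕) (p := p) x hp h

theorem add_mul' (x y z : SemicrossedProduct 𝓕) : (x + y) * z = x * z + y * z := by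
  refine ind x (isClosed_eq (by fun_prop) (by fun_prop)) fun x => ?_
  refine ind y (isClosed_eq (by fun_prop) (by fun_prop)) fun y => ?_
  refine ind z (isClosed_eq (by fun_prop) (by fun_prop)) fun z => ?_
  simp only [← ofPoly_mul, ← map_add, add_mul]

theorem mul_add' (x y z : SemicrossedProduct 𝓕) : x * (y + z) = x * y + x * z := by
  refine ind x (isClosed_eq (by fun_prop) (by fun_prop)) fun x => ?_
  refine ind y (isClosed_eq (by fun_prop) (by fun_prop)) fun y => ?_
  refine ind z (isClosed_eq (by fun_prop) (by fun_prop)) fun z => ?_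
  simp only [← ofPoly_mul, ← map_add, mul_add]

theorem mul_assoc' (x y z : SemicrossedProduct 𝓕) : x * y * z = x * (y * z) := by
  refine ind x (isClosed_eq ((continuous_id.mul continuous_const).mul continuous_const)
    (continuous_id.mul continuous_const)) fun x => ?_
  refine ind y (isClosed_eq ((continuous_const.mul continuous_id).mul continuous_const)
    (continuous_const.mul (continuous_id.mul continuous_const))) fun y => ?_
  refine ind z (isClosed_eq (continuous_const.mul continuous_id)
    (continuous_const.mul (continuous_const.mul continuous_id))) fun z => ?_
  rw [← ofPoly_mul, ← ofPoly_mul, ← ofPoly_mul, ← ofPoly_mul, mul_assoc]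

theorem continuous_smul' (c : ℂ) : Continuous fun x : SemicrossedProduct 𝓕 => c • x :=
  continuous_const_smul c

theorem smul_mul' (c : ℂ) (x y : SemicrossedProduct 𝓕) : (c • x) * y = c • (x * y) := by
  refine ind x (isClosed_eq ((continuous_smul' c).mul continuous_const)
    ((continuous_smul' c).comp (continuous_id.mul continuous_const))) fun x => ?_
  refine ind y (isClosed_eq (continuous_const.mul continuous_id)
    ((continuous_smul' c).comp (continuous_const.mul continuous_id))) fun y => ?_
  simp only [← ofPoly_mul, ← map_smul, smul_mul_assoc]

theorem mul_smul' (c : ℂ) (x y : SemicrossedProduct 𝓕) : x * (c • y) = c • (x * y) := by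
  refine ind x (isClosed_eq (continuous_id.mul continuous_const)
    ((continuous_smul' c).comp (continuous_id.mul continuous_const))) fun x => ?_
  refine ind y (isClosed_eq (continuous_const.mul (continuous_smul' c))
    ((continuous_smul' c).comp (continuous_const.mul continuous_id))) fun y => ?_
  simp only [← ofPoly_mul, ← map_smul, mul_smul_comm]

theorem norm_mul_le' (x y : SemicrossedProduct 𝓕) : ‖x * y‖ ≤ ‖x‖ * ‖y‖ := by
  refine ind x (isClosed_le (continuous_id.mul continuous_const).norm
    (continuous_norm.mul continuous_const)) fun x => ?_
  refine ind y (isClosed_le (continuous_const.mul continuous_id).norm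
    (continuous_const.mul continuous_norm)) fun y => ?_
  rw [← ofPoly_mul, norm_ofPoly, norm_ofPoly, norm_ofPoly]
  exact norm_mul_le (α := NormedPoly 𝓕) x y

/-- The semicrossed product is a (not necessarily unital) Banach algebra. -/
instance : NonUnitalNormedRing (SemicrossedProduct 𝓕) where
  __ := (inferInstance : NormedAddCommGroup (SemicrossedProduct 𝓕))
  __ := (inferInstance : Mul (SemicrossedProduct 𝓕))
  left_distrib := mul_add'
  right_distrib := add_mul'
  zero_mul x := by simpa using add_mul' 0 0 x
  mul_zero x := by simpa using mul_add' x 0 0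
  mul_assoc := mul_assoc'
  norm_mul_le := norm_mul_le'

instance : IsScalarTower ℂ (SemicrossedProduct 𝓕) (SemicrossedProduct 𝓕) where
  smul_assoc := smul_mul'

instance : SMulCommClass ℂ (SemicrossedProduct 𝓕) (SemicrossedProduct 𝓕) where
  smul_comm c x y := (mul_smul' c x y).symm

end SemicrossedProduct

end FamilyNorm

end Polynomials

section Nica

variable {G : Type v} [CommGroup G] [Lattice G] [IsOrderedMonoid G]
  {A : Type u} [NonUnitalCStarAlgebra A]

/-- The pair `(π, T)` is Nica-covariant if `T(s) T(t)^* = T(t)^* T(s)` whenever `s ∧ t = e`. Here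
`P = {g | e ≤ g}` is the positive cone of the abelian lattice ordered group `G`. -/
def IsNica {α : Submonoid.oneLE G →* (A →⋆ₙₐ[ℂ] A)} (X : CovariantPair.{u, v, w} α) : Prop :=
  ∀ s t : Submonoid.oneLE G, (s : G) ⊓ (t : G) = 1 →
    X.T s * ContinuousLinearMap.adjoint (X.T t) = ContinuousLinearMap.adjoint (X.T t) * X.T s

/-- The pair `(π, T)` is isometric if every `T(s)` is an isometry. -/
def IsIsometric {α : Submonoid.oneLE G →* (A →⋆ₙₐ[ℂ] A)} (X : CovariantPair.{u, v, w} α) : Prop :=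
  ∀ s : Submonoid.oneLE G, Isometry (X.T s)

variable (α : Submonoid.oneLE G →* (A →⋆ₙₐ[ℂ] A))

/-- The family of all Nica-covariant pairs. -/
def nc : Set (CovariantPair.{u, v, w} α) := {X | IsNica X}

/-- The family of all isometric Nica-covariant pairs. -/
def ncIso : Set (CovariantPair.{u, v, w} α) := {X | IsNica X ∧ IsIsometric X}

end Nica

end Semicrossed

end

/-! Isometric pairs form a subfamily, so only one inequality of norms is at stake. It follows once
every Nica-covariant pair `(π, T)` on `H` is shown to be a compression of an isometric
Nica-covariant pair: then ‖(π × T)(q)‖ is at most the norm of the dilated polynomial.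

The dilation lives on the Kolmogorov space of the kernel K(p, q) = T(p(p∧q)⁻¹)* T(q(p∧q)⁻¹) on `P`.
This kernel is invariant under translation, so translations act as isometries. `H` sits at the point
e, and A acts at the point p through π ∘ α_p, which intertwines K by covariance
(`regularKernel_intertwine`). Nica-covariance of `T` yields an explicit adjoint for the translations
(`adjoint_shiftHom_emb`), and hence their Nica-covariance.

The main difficulty is positivity of K (`kernelForm_regularKernel_nonneg`). Moving a vector from p
down to p∧c by T(p(p∧c)⁻¹) is a formally self-adjoint idempotent, and these idempotents commute. In
a finite sublattice, induct on an upper bound d. Splitting off the parts below the maximal elements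
c < d leaves positive terms and a contribution of the d-th coordinate alone. That contribution is
the quadratic form of a product of defects 1 − T(d/c)*T(d/c). Distinct maximal c have join d, so the
elements d/c are pairwise disjoint; by Nica-covariance the defects commute, and their product is
positive. -/

noncomputable section

namespace Semicrossed

/-! ### Arithmetic of excesses in the positive cone. -/

section PositiveCone

variable {G : Type v} [CommGroup G] [Lattice G] [IsOrderedMonoid G]

/-- The positive cone of an abelian lattice ordered group is a distributive lattice. -/
instance : DistribLattice (Submonoid.oneLE G) where
  __ := (Subtype.lattice (fun _ _ hx _ => le_sup_of_le_left hx) (fun _ _ hx hy => le_inf hx hy) :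
    Lattice {x : G // x ∈ Submonoid.oneLE G})
  le_sup_inf x y z := (CommGroup.toDistribLattice G).le_sup_inf x y z

theorem coe_inf_oneLE (p q : Submonoid.oneLE G) :
    ((p ⊓ q : Submonoid.oneLE G) : G) = (p : G) ⊓ q := rfl

theorem coe_sup_oneLE (p q : Submonoid.oneLE G) :
    ((p ⊔ q : Submonoid.oneLE G) : G) = (p : G) ⊔ q := rfl

theorem one_le_coe (p : Submonoid.oneLE G) : (1 : G) ≤ p := p.2

/-- The excess `p (p ∧ q)⁻¹` of `p` over `q`. -/
def exc (p q : Submonoid.oneLE G) : Submonoid.oneLE G :=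
  ⟨p / ((p : G) ⊓ q), one_le_div'.2 inf_le_left⟩

theorem coe_exc (p q : Submonoid.oneLE G) : (exc p q : G) = p / ((p : G) ⊓ q) := rfl

theorem coe_exc_eq_sup (p q : Submonoid.oneLE G) : (exc p q : G) = (p : G) / q ⊔ 1 := by
  rw [coe_exc, div_inf, div_self', sup_comm]

theorem exc_mul_inf (p q : Submonoid.oneLE G) : exc p q * (p ⊓ q) = p :=
  Subtype.ext (by simp [coe_exc, coe_inf_oneLE])

/-- Telescoping along p ≥ p∧c ≥ p∧c∧q. The algebra of the cut-off projections rests on this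
identity. -/
theorem exc_mul_exc_inf (p q c : Submonoid.oneLE G) :
    exc p c * exc (p ⊓ c) q = exc p (q ⊓ c) :=
  Subtype.ext (by
    simp only [Submonoid.coe_mul, coe_exc, coe_inf_oneLE, div_mul_div_cancel]
    rw [inf_assoc, inf_comm (c : G)])

theorem exc_of_le {p q : Submonoid.oneLE G} (h : p ≤ q) : exc p q = 1 :=
  Subtype.ext (by simp [coe_exc, inf_eq_left.2 (show (p : G) ≤ q from h)])

theorem exc_one_right (p : Submonoid.oneLE G) : exc p 1 = p :=
  Subtype.ext (by simp [coe_exc, one_le_coe])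

theorem exc_one_left (p : Submonoid.oneLE G) : exc 1 p = 1 :=
  exc_of_le p.2

theorem exc_mul_mul_left (r p q : Submonoid.oneLE G) : exc (r * p) (r * q) = exc p q :=
  Subtype.ext (by simp [coe_exc_eq_sup])

theorem exc_inf_exc (p q : Submonoid.oneLE G) : (exc p q : G) ⊓ (exc q p : G) = 1 := by
  rw [coe_exc, coe_exc, inf_comm (q : G), ← inf_div, div_self']

theorem exc_inf_exc_of_sup_eq {d c c' : Submonoid.oneLE G} (h : c ⊔ c' = d) :
    (exc d c : G) ⊓ (exc d c' : G) = 1 := by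
  subst h
  simp only [coe_exc, coe_sup_oneLE, inf_eq_right.2 (le_sup_left : (c : G) ≤ (c : G) ⊔ c'),
    inf_eq_right.2 (le_sup_right : (c' : G) ≤ (c : G) ⊔ c')]
  rw [← div_sup, div_self']

/-- Disjointness says that d∧c and d∧c' have join d. The identity (a∧b)(a∨b) = ab for these two
elements then gives (d∧c)/(d∧c∧c') = d/(d∧c'). -/
theorem exc_inf_left_of_disjoint {d c c' : Submonoid.oneLE G}
    (h : (exc d c : G) ⊓ (exc d c' : G) = 1) : exc (d ⊓ c) c' = exc d c' := by
  have h1 : ((d : G) ⊓ c) ⊔ ((d : G) ⊓ c') = d := by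
    rw [coe_exc, coe_exc, ← div_sup, div_eq_one] at h
    exact h.symm
  have h2 := inf_mul_sup ((d : G) ⊓ c) ((d : G) ⊓ c')
  have h3 : (d : G) ⊓ c ⊓ ((d : G) ⊓ c') = (d : G) ⊓ c ⊓ c' := by
    rw [← inf_assoc, inf_right_comm (d : G) c d, inf_idem]
  refine Subtype.ext ?_
  rw [h1, h3] at h2
  simp only [coe_exc, coe_inf_oneLE]
  rw [div_eq_div_iff_mul_eq_mul, ← h2, mul_comm]

theorem exc_mul_right (p t q : Submonoid.oneLE G) : exc p (t * q) = exc (exc p t) q := by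
  refine Subtype.ext ?_
  simp only [coe_exc_eq_sup, Submonoid.coe_mul, sup_div, div_div]
  rw [sup_assoc, sup_eq_right.2 (div_le_one'.2 (one_le_coe q))]

/-- Additively, (t + q − p)⁺ = (t − p)⁺ + (q − (p − t)⁺)⁺, because t − p is the difference of its
positive part (t − p)⁺ and its negative part (p − t)⁺. -/
theorem exc_mul_left (p t q : Submonoid.oneLE G) :
    exc (t * q) p = exc t p * exc q (exc p t) := by
  refine Subtype.ext ?_
  simp only [coe_exc_eq_sup, Submonoid.coe_mul]
  have h : ((t : G) / p ⊔ 1) / ((p : G) / t ⊔ 1) = (t : G) / p := by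
    rw [div_eq_iff_eq_mul, mul_sup, div_mul_div_cancel, div_self', mul_one, sup_comm]
  rw [mul_sup, mul_one, mul_div_left_comm, h, mul_comm, ← sup_assoc,
    sup_eq_left.2 (le_mul_of_one_le_left' (one_le_coe q)), mul_div_assoc]

/-- The quotient of the left side by p lies below both s and t, hence below s∧t = e. -/
theorem inf_mul_of_disjoint {s t : Submonoid.oneLE G} (h : (s : G) ⊓ t = 1)
    (p : Submonoid.oneLE G) : (t : G) ⊓ (s * p) = (t : G) ⊓ p := by
  refine le_antisymm (le_inf inf_le_left ?_)
    (inf_le_inf_left _ (le_mul_of_one_le_left' (one_le_coe s)))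
  rw [← div_le_one', ← h]
  refine le_inf (div_le_iff_le_mul.2 inf_le_right) ?_
  exact ((div_le_self_iff _).2 (one_le_coe p)).trans inf_le_left

theorem exc_mul_of_disjoint {s t : Submonoid.oneLE G} (h : (s : G) ⊓ t = 1)
    (p : Submonoid.oneLE G) : exc (s * p) t = s * exc p t := by
  refine Subtype.ext ?_
  simp only [coe_exc, Submonoid.coe_mul]
  rw [inf_comm, inf_mul_of_disjoint h, inf_comm, mul_div_assoc]

theorem exc_mul_of_disjoint' {s t : Submonoid.oneLE G} (h : (s : G) ⊓ t = 1)
    (p : Submonoid.oneLE G) : exc t (s * p) = exc t p := by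
  refine Subtype.ext ?_
  simp only [coe_exc, Submonoid.coe_mul]
  rw [inf_mul_of_disjoint h]

theorem exc_exc_inf (p t q : Submonoid.oneLE G) :
    (exc (exc p t) q : G) ⊓ (exc t p : G) = 1 := by
  refine le_antisymm ?_ (le_inf (one_le_coe _) (one_le_coe _))
  rw [← exc_inf_exc p t]
  refine inf_le_inf_right _ ?_
  rw [coe_exc (exc p t)]
  exact (div_le_self_iff _).2 (le_inf (one_le_coe _) (one_le_coe _))

end PositiveCone

/-! ### Operator-valued positive definite kernels and their Kolmogorov spaces. -/

section PositiveKernel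

variable {ι : Type*} {H : Type*} [NormedAddCommGroup H] [InnerProductSpace ℂ H]

local notation "⟪" x ", " y "⟫" => inner ℂ x y

/-- The sesquilinear form on `ι →₀ H` given by an operator valued kernel. -/
def kernelForm (K : ι → ι → H →L[ℂ] H) (x y : ι →₀ H) : ℂ :=
  x.sum fun p h => y.sum fun q k => ⟪h, K p q k⟫

section KernelForm

variable (K : ι → ι → H →L[ℂ] H)

theorem kernelForm_add_left (x y z : ι →₀ H) :
    kernelForm K (x + y) z = kernelForm K x z + kernelForm K y z := by
  classical
  refine Finsupp.sum_add_index' (fun p => ?_) (fun p h k => ?_)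
  · simp [Finsupp.sum]
  · simp [Finsupp.sum, Finset.sum_add_distrib]

theorem kernelForm_add_right (x y z : ι →₀ H) :
    kernelForm K x (y + z) = kernelForm K x y + kernelForm K x z := by
  classical
  unfold kernelForm
  rw [← Finsupp.sum_add]
  refine Finsupp.sum_congr fun p _ => Finsupp.sum_add_index' (fun q => ?_) (fun q h k => ?_)
  · simp
  · simp

theorem kernelForm_zero_left (y : ι →₀ H) : kernelForm K 0 y = 0 := Finsupp.sum_zero_index

theorem kernelForm_zero_right (x : ι →₀ H) : kernelForm K x 0 = 0 := by
  simp [kernelForm]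

theorem kernelForm_single_single (p q : ι) (h k : H) :
    kernelForm K (Finsupp.single p h) (Finsupp.single q k) = ⟪h, K p q k⟫ := by
  unfold kernelForm
  rw [Finsupp.sum_single_index, Finsupp.sum_single_index] <;> simp

theorem kernelForm_smul_left (c : ℂ) (x y : ι →₀ H) :
    kernelForm K (c • x) y = starRingEnd ℂ c * kernelForm K x y := by
  induction x using Finsupp.induction_linear with
  | zero => simp [kernelForm_zero_left]
  | add x x' hx hx' => rw [smul_add, kernelForm_add_left, kernelForm_add_left, hx, hx', mul_add]
  | single p h =>
    induction y using Finsupp.induction_linear with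
    | zero => simp [kernelForm_zero_right]
    | add y y' hy hy' => rw [kernelForm_add_right, kernelForm_add_right, hy, hy', mul_add]
    | single q k => simp [kernelForm_single_single, mul_comm]

/-- Two linear maps are formal adjoints with respect to kernel forms if they are so on
elementary vectors. -/
theorem kernelForm_map_eq {κ : Type*} {K : ι → ι → H →L[ℂ] H} {K' : κ → κ → H →L[ℂ] H}
    {f : (ι →₀ H) →ₗ[ℂ] (κ →₀ H)} {g : (κ →₀ H) →ₗ[ℂ] (ι →₀ H)}
    (h : ∀ p q v w, kernelForm K' (f (Finsupp.single p v)) (Finsupp.single q w) =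
      kernelForm K (Finsupp.single p v) (g (Finsupp.single q w))) (x : ι →₀ H) (y : κ →₀ H) :
    kernelForm K' (f x) y = kernelForm K x (g y) := by
  induction x using Finsupp.induction_linear with
  | zero => simp [kernelForm_zero_left]
  | add x x' hx hx' => rw [map_add, kernelForm_add_left, kernelForm_add_left, hx, hx']
  | single p v =>
    induction y using Finsupp.induction_linear with
    | zero => simp [kernelForm_zero_right]
    | add y y' hy hy' => rw [map_add, kernelForm_add_right, kernelForm_add_right, hy, hy']
    | single q w => exact h p q v w

/-- A linear map preserves kernel forms if it does so on elementary vectors. -/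
theorem kernelForm_map_map {κ : Type*} {K : ι → ι → H →L[ℂ] H} {K' : κ → κ → H →L[ℂ] H}
    {f : (ι →₀ H) →ₗ[ℂ] (κ →₀ H)}
    (h : ∀ p q v w, kernelForm K' (f (Finsupp.single p v)) (f (Finsupp.single q w)) =
      kernelForm K (Finsupp.single p v) (Finsupp.single q w)) (x y : ι →₀ H) :
    kernelForm K' (f x) (f y) = kernelForm K x y := by
  induction x using Finsupp.induction_linear with
  | zero => simp [kernelForm_zero_left]
  | add x x' hx hx' => rw [map_add, kernelForm_add_left, kernelForm_add_left, hx, hx']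
  | single p v =>
    induction y using Finsupp.induction_linear with
    | zero => simp [kernelForm_zero_right]
    | add y y' hy hy' => rw [map_add, kernelForm_add_right, kernelForm_add_right, hy, hy']
    | single q w => exact h p q v w

theorem kernelForm_sub_left (x y z : ι →₀ H) :
    kernelForm K (x - y) z = kernelForm K x z - kernelForm K y z := by
  rw [eq_sub_iff_add_eq, ← kernelForm_add_left, sub_add_cancel]

theorem kernelForm_sub_right (x y z : ι →₀ H) :
    kernelForm K x (y - z) = kernelForm K x y - kernelForm K x z := by
  rw [eq_sub_iff_add_eq, ← kernelForm_add_right, sub_add_cancel]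

theorem kernelForm_smul_right (c : ℂ) (x y : ι →₀ H) :
    kernelForm K x (c • y) = c * kernelForm K x y := by
  induction x using Finsupp.induction_linear with
  | zero => simp [kernelForm_zero_left]
  | add x x' hx hx' => rw [kernelForm_add_left, kernelForm_add_left, hx, hx', mul_add]
  | single p h =>
    induction y using Finsupp.induction_linear with
    | zero => simp [kernelForm_zero_right]
    | add y y' hy hy' => rw [smul_add, kernelForm_add_right, kernelForm_add_right, hy, hy', mul_add]
    | single q k => simp [kernelForm_single_single]

end KernelForm

variable (ι H) in
/-- A positive definite operator valued kernel. -/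
structure PosKernel where
  /-- The kernel. -/
  ker : ι → ι → H →L[ℂ] H
  inner_symm : ∀ p q h k, ⟪ker p q h, k⟫ = ⟪h, ker q p k⟫
  nonneg : ∀ x : ι →₀ H, 0 ≤ (kernelForm ker x x).re

namespace PosKernel

variable (K : PosKernel ι H)

theorem kernelForm_symm (x y : ι →₀ H) :
    starRingEnd ℂ (kernelForm K.ker y x) = kernelForm K.ker x y := by
  induction x using Finsupp.induction_linear with
  | zero => simp [kernelForm_zero_left, kernelForm_zero_right]
  | add x x' hx hx' => rw [kernelForm_add_left, kernelForm_add_right, map_add, hx, hx']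
  | single p h =>
    induction y using Finsupp.induction_linear with
    | zero => simp [kernelForm_zero_left, kernelForm_zero_right]
    | add y y' hy hy' => rw [kernelForm_add_left, kernelForm_add_right, map_add, hy, hy']
    | single q k => rw [kernelForm_single_single, kernelForm_single_single, inner_conj_symm,
        K.inner_symm]

/-- The space `ι →₀ H` with the semi-inner product of a positive definite kernel. -/
@[nolint unusedArguments]
def PreSpace (_K : PosKernel ι H) := ι →₀ H

instance : AddCommGroup K.PreSpace := inferInstanceAs (AddCommGroup (ι →₀ H))

instance : Module ℂ K.PreSpace := inferInstanceAs (Module ℂ (ι →₀ H))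

/-- The semi-inner product of a positive definite kernel. -/
abbrev preCore : PreInnerProductSpace.Core ℂ K.PreSpace where
  inner x y := kernelForm K.ker x y
  conj_inner_symm := K.kernelForm_symm
  re_inner_nonneg := K.nonneg
  add_left := kernelForm_add_left K.ker
  smul_left x y c := kernelForm_smul_left K.ker c x y

instance : SeminormedAddCommGroup K.PreSpace :=
  InnerProductSpace.Core.toSeminormedAddCommGroup (c := K.preCore)

instance : InnerProductSpace ℂ K.PreSpace := InnerProductSpace.ofCore K.preCore

/-- The Kolmogorov space of a positive definite kernel. -/
abbrev Space := UniformSpace.Completion K.PreSpace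

/-- The canonical map to the Kolmogorov space. -/
def of : (ι →₀ H) →ₗ[ℂ] K.Space :=
  (UniformSpace.Completion.toComplₗᵢ : K.PreSpace →ₗᵢ[ℂ] K.Space).toLinearMap

theorem inner_of_of (x y : ι →₀ H) : ⟪K.of x, K.of y⟫ = kernelForm K.ker x y :=
  UniformSpace.Completion.inner_coe (E := K.PreSpace) x y

theorem norm_of (x : K.PreSpace) : ‖K.of x‖ = ‖x‖ :=
  UniformSpace.Completion.norm_coe (E := K.PreSpace) x

theorem norm_of_sq (x : ι →₀ H) : ‖K.of x‖ ^ 2 = (kernelForm K.ker x x).re := by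
  rw [← inner_of_of, ← inner_self_eq_norm_sq (𝕜 := ℂ)]
  rfl

/-- The elementary vectors of the Kolmogorov space. -/
def emb (p : ι) : H →ₗ[ℂ] K.Space := K.of ∘ₗ Finsupp.lsingle p

theorem emb_apply (p : ι) (h : H) : K.emb p h = K.of (Finsupp.single p h) := rfl

theorem inner_emb_emb (p q : ι) (h k : H) : ⟪K.emb p h, K.emb q k⟫ = ⟪h, K.ker p q k⟫ := by
  rw [emb_apply, emb_apply, inner_of_of, kernelForm_single_single]

variable {K}

theorem clm_ext {E : Type*} [NormedAddCommGroup E] [NormedSpace ℂ E] {f g : K.Space →L[ℂ] E}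
    (h : ∀ p v, f (K.emb p v) = g (K.emb p v)) : f = g := by
  ext x
  induction x using UniformSpace.Completion.induction_on with
  | hp => exact isClosed_eq f.continuous g.continuous
  | ih x =>
    have : (f : K.Space →ₗ[ℂ] E) ∘ₗ K.of = (g : K.Space →ₗ[ℂ] E) ∘ₗ K.of :=
      Finsupp.lhom_ext h
    exact DFunLike.congr_fun this x

theorem ext_inner_emb {x y : K.Space} (h : ∀ p v, ⟪x, K.emb p v⟫ = ⟪y, K.emb p v⟫) : x = y := by
  have : innerSL ℂ x = innerSL ℂ y := clm_ext h
  exact ext_inner_right ℂ fun v => DFunLike.congr_fun this v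

/-- The operator on the Kolmogorov space induced by a bounded linear map on `ι →₀ H`. -/
def lift (f : (ι →₀ H) →ₗ[ℂ] (ι →₀ H)) (C : ℝ) (hf : ∀ x, ‖K.of (f x)‖ ≤ C * ‖K.of x‖) :
    K.Space →L[ℂ] K.Space :=
  ((show K.PreSpace →ₗ[ℂ] K.PreSpace from f).mkContinuous C fun x =>
    (norm_of K (f x)).symm.trans_le
      ((hf x).trans_eq (congrArg (C * ·) (norm_of K x)))).completion

theorem lift_of (f : (ι →₀ H) →ₗ[ℂ] (ι →₀ H)) (C : ℝ)
    (hf : ∀ x, ‖K.of (f x)‖ ≤ C * ‖K.of x‖) (x : ι →₀ H) :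
    lift f C hf (K.of x) = K.of (f x) :=
  ContinuousLinearMap.completion_apply_coe _ _

/-- The linear map on `ι →₀ H` that sends the elementary vector of `h` at `p` to that of `a p h`
at `r p`. -/
def weightedMap (r : ι → ι) (a : ι → H →L[ℂ] H) : (ι →₀ H) →ₗ[ℂ] (ι →₀ H) :=
  Finsupp.lsum ℂ fun p => (Finsupp.lsingle (r p)).comp (a p : H →ₗ[ℂ] H)

theorem weightedMap_single (r : ι → ι) (a : ι → H →L[ℂ] H) (p : ι) (h : H) :
    weightedMap r a (Finsupp.single p h) = Finsupp.single (r p) (a p h) := by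
  simp [weightedMap]

theorem norm_of_le_mul {C : ℝ} (hC : 0 ≤ C) {x y : ι →₀ H}
    (h : (kernelForm K.ker y y).re ≤ C ^ 2 * (kernelForm K.ker x x).re) :
    ‖K.of y‖ ≤ C * ‖K.of x‖ := by
  refine le_of_sq_le_sq ?_ (mul_nonneg hC (norm_nonneg _))
  rwa [mul_pow, norm_of_sq, norm_of_sq]

end PosKernel

end PositiveKernel

/-! ### Positivity of the kernel of a contractive Nica-covariant representation. -/

section Positivity

variable {G : Type v} [CommGroup G] [Lattice G] [IsOrderedMonoid G]
  {H : Type*} [NormedAddCommGroup H] [InnerProductSpace ℂ H]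
  (T : Submonoid.oneLE G →* (H →L[ℂ] H))

local notation "⟪" x ", " y "⟫" => inner ℂ x y

open ContinuousLinearMap (adjoint adjoint_inner_left adjoint_inner_right)
open PosKernel (weightedMap weightedMap_single)

/-- The formal orthogonal projection of `P →₀ H` onto the span of the elementary vectors at
points below `c`. -/
def cutOff (c : Submonoid.oneLE G) : Module.End ℂ (Submonoid.oneLE G →₀ H) :=
  weightedMap (fun p => p ⊓ c) (fun p => T (exc p c))

theorem cutOff_single (c p : Submonoid.oneLE G) (h : H) :
    cutOff T c (Finsupp.single p h) = Finsupp.single (p ⊓ c) (T (exc p c) h) :=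
  weightedMap_single _ _ _ _

theorem cutOff_single_of_le {c p : Submonoid.oneLE G} (hp : p ≤ c) (h : H) :
    cutOff T c (Finsupp.single p h) = Finsupp.single p h := by
  rw [cutOff_single, exc_of_le hp, inf_eq_left.2 hp, map_one]
  rfl

theorem cutOff_mul_cutOff (c d : Submonoid.oneLE G) :
    cutOff T c * cutOff T d = cutOff T (c ⊓ d) := by
  refine Finsupp.lhom_ext fun p h => ?_
  rw [Module.End.mul_apply, cutOff_single, cutOff_single, cutOff_single, ← exc_mul_exc_inf p c d,
    inf_assoc, inf_comm d c, mul_comm, map_mul]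
  rfl

theorem commute_cutOff (c d : Submonoid.oneLE G) : Commute (cutOff T c) (cutOff T d) := by
  rw [commute_iff_eq, cutOff_mul_cutOff, cutOff_mul_cutOff, inf_comm]

theorem cutOff_cutOff (c : Submonoid.oneLE G) (x : Submonoid.oneLE G →₀ H) :
    cutOff T c (cutOff T c x) = cutOff T c x := by
  rw [← Module.End.mul_apply, cutOff_mul_cutOff, inf_idem]

/-- The product of the complements of the projections `cutOff T c`, `c ∈ L`. -/
def cutComplement (L : List (Submonoid.oneLE G)) : Module.End ℂ (Submonoid.oneLE G →₀ H) :=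
  (L.map fun c => 1 - cutOff T c).prod

theorem cutComplement_nil : cutComplement T [] = 1 := rfl

theorem cutComplement_cons (c : Submonoid.oneLE G) (L : List (Submonoid.oneLE G)) :
    cutComplement T (c :: L) = (1 - cutOff T c) * cutComplement T L := by
  simp [cutComplement]

theorem commute_cutOff_cutComplement (c : Submonoid.oneLE G) (L : List (Submonoid.oneLE G)) :
    Commute (cutOff T c) (cutComplement T L) := by
  refine Commute.list_prod_right _ _ fun y hy => ?_
  obtain ⟨d, -, rfl⟩ := List.mem_map.1 hy
  exact (Commute.one_right _).sub_right (commute_cutOff T c d)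

theorem commute_one_sub_cutComplement (c : Submonoid.oneLE G) (L : List (Submonoid.oneLE G)) :
    Commute (1 - cutOff T c) (cutComplement T L) :=
  (Commute.one_left _).sub_left (commute_cutOff_cutComplement T c L)

theorem isIdempotentElem_cutComplement (L : List (Submonoid.oneLE G)) :
    IsIdempotentElem (cutComplement T L) := by
  induction L with
  | nil => exact IsIdempotentElem.one
  | cons c L ih =>
    rw [cutComplement_cons]
    refine IsIdempotentElem.mul_of_commute (commute_one_sub_cutComplement T c L) ?_ ih
    refine IsIdempotentElem.one_sub ?_
    rw [IsIdempotentElem, cutOff_mul_cutOff, inf_idem]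

/-- The factor at c kills the vector, and since all factors commute it may be applied first. -/
theorem cutComplement_single_of_le {L : List (Submonoid.oneLE G)} {c p : Submonoid.oneLE G}
    (hc : c ∈ L) (hp : p ≤ c) (h : H) : cutComplement T L (Finsupp.single p h) = 0 := by
  induction L with
  | nil => simp at hc
  | cons d L ih =>
    rw [cutComplement_cons]
    rcases List.mem_cons.1 hc with rfl | hc
    · rw [(commute_one_sub_cutComplement T c L).eq, Module.End.mul_apply, LinearMap.sub_apply,
        cutOff_single_of_le T hp, Module.End.one_apply, sub_self, map_zero]
    · rw [Module.End.mul_apply, ih hc, map_zero]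

theorem cutOff_mem_supported {F : Finset (Submonoid.oneLE G)}
    (hF : ∀ a ∈ F, ∀ b ∈ F, a ⊓ b ∈ F) {c : Submonoid.oneLE G} (hc : c ∈ F)
    {x : Submonoid.oneLE G →₀ H} (hx : x ∈ Finsupp.supported H ℂ (F : Set (Submonoid.oneLE G))) :
    cutOff T c x ∈ Finsupp.supported H ℂ {a | a ∈ F ∧ a ≤ c} := by
  classical
  rw [← Finsupp.sum_single x, Finsupp.sum, map_sum]
  refine Submodule.sum_mem _ fun p hp => ?_
  rw [cutOff_single]
  exact Finsupp.single_mem_supported _ _ ⟨hF _ ((Finsupp.mem_supported _ _).1 hx hp) _ hc,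
    inf_le_right⟩

variable [CompleteSpace H]

/-- The kernel `(p, q) ↦ T(p - p ∧ q)^* T(q - p ∧ q)` (written additively). -/
def regularKernel (p q : Submonoid.oneLE G) : H →L[ℂ] H :=
  adjoint (T (exc p q)) * T (exc q p)

theorem inner_regularKernel (p q : Submonoid.oneLE G) (h k : H) :
    ⟪h, regularKernel T p q k⟫ = ⟪T (exc p q) h, T (exc q p) k⟫ := by
  rw [regularKernel, mul_apply_eq_comp, adjoint_inner_right]

/-- With m = p∧q∧c, both sides on elementary vectors are the inner product of T(p/m)h and T(q/m)k.
-/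
theorem kernelForm_cutOff (c : Submonoid.oneLE G) (x y : Submonoid.oneLE G →₀ H) :
    kernelForm (regularKernel T) (cutOff T c x) y =
      kernelForm (regularKernel T) x (cutOff T c y) := by
  refine kernelForm_map_eq (fun p q h k => ?_) x y
  have h1 : T (exc (p ⊓ c) q) (T (exc p c) h) = T (exc p (q ⊓ c)) h := by
    rw [← exc_mul_exc_inf p q c, mul_comm, map_mul]
    rfl
  have h2 : T (exc (q ⊓ c) p) (T (exc q c) k) = T (exc q (p ⊓ c)) k := by
    rw [← exc_mul_exc_inf q p c, mul_comm, map_mul]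
    rfl
  rw [cutOff_single, cutOff_single, kernelForm_single_single, kernelForm_single_single,
    inner_regularKernel, inner_regularKernel, h1, h2]

theorem kernelForm_self_eq_add (c : Submonoid.oneLE G) (x : Submonoid.oneLE G →₀ H) :
    kernelForm (regularKernel T) x x =
      kernelForm (regularKernel T) (cutOff T c x) (cutOff T c x) +
        kernelForm (regularKernel T) ((1 - cutOff T c) x) ((1 - cutOff T c) x) := by
  have h : kernelForm (regularKernel T) (cutOff T c x) (cutOff T c x) =
      kernelForm (regularKernel T) x (cutOff T c x) := by
    rw [kernelForm_cutOff, cutOff_cutOff]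
  rw [LinearMap.sub_apply, Module.End.one_apply, kernelForm_sub_left, kernelForm_sub_right,
    kernelForm_sub_right, h, kernelForm_cutOff T c x x]
  ring

theorem kernelForm_cutComplement (L : List (Submonoid.oneLE G))
    (x y : Submonoid.oneLE G →₀ H) :
    kernelForm (regularKernel T) (cutComplement T L x) y =
      kernelForm (regularKernel T) x (cutComplement T L y) := by
  induction L generalizing x y with
  | nil => rfl
  | cons c L ih =>
    have h : ∀ x y, kernelForm (regularKernel T) ((1 - cutOff T c) x) y =
        kernelForm (regularKernel T) x ((1 - cutOff T c) y) := fun x y => by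
      simp only [LinearMap.sub_apply, Module.End.one_apply, kernelForm_sub_left,
        kernelForm_sub_right, kernelForm_cutOff]
    rw [cutComplement_cons, Module.End.mul_apply, h, ih, ← Module.End.mul_apply,
      (commute_one_sub_cutComplement T c L).eq]

/-- Pythagoras, once for each c in `L`: the part cut off at c lives below c, where positivity is
already known, and meet-closure keeps all vectors supported in `F`. Only the common complement
remains to be tested. -/
theorem kernelForm_nonneg_of_cutComplement {F : Finset (Submonoid.oneLE G)}
    (hF : ∀ a ∈ F, ∀ b ∈ F, a ⊓ b ∈ F) (L : List (Submonoid.oneLE G)) (hL : ∀ c ∈ L, c ∈ F)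
    (hpos : ∀ c ∈ L, ∀ x ∈ Finsupp.supported H ℂ {a | a ∈ F ∧ a ≤ c},
      0 ≤ (kernelForm (regularKernel T) x x).re)
    {x : Submonoid.oneLE G →₀ H} (hx : x ∈ Finsupp.supported H ℂ (F : Set (Submonoid.oneLE G)))
    (h : 0 ≤ (kernelForm (regularKernel T) (cutComplement T L x) (cutComplement T L x)).re) :
    0 ≤ (kernelForm (regularKernel T) x x).re := by
  induction L generalizing x with
  | nil => exact h
  | cons c L ih =>
    have hcx := cutOff_mem_supported T hF (hL c List.mem_cons_self) hx
    rw [kernelForm_self_eq_add T c, Complex.add_re]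
    refine add_nonneg (hpos c List.mem_cons_self _ hcx) ?_
    refine ih (fun d hd => hL d (List.mem_cons_of_mem _ hd))
      (fun d hd => hpos d (List.mem_cons_of_mem _ hd)) ?_ ?_
    · exact Submodule.sub_mem _ hx (Finsupp.supported_mono (fun a ha => ha.1) hcx)
    · rwa [← Module.End.mul_apply, ← (commute_one_sub_cutComplement T c L).eq,
        ← cutComplement_cons]

variable {T}

/-- Nica-covariance of a representation of the positive cone. -/
def NicaRep (T : Submonoid.oneLE G →* (H →L[ℂ] H)) : Prop :=
  ∀ s t : Submonoid.oneLE G, (s : G) ⊓ (t : G) = 1 → Commute (T s) (adjoint (T t))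

theorem commute_defect (hT : NicaRep T) {a b : Submonoid.oneLE G} (h : (a : G) ⊓ b = 1) :
    Commute (T a) (1 - adjoint (T b) * T b) :=
  (Commute.one_right _).sub_right ((hT a b h).mul_right (((Commute.all a b).map T)))

/-- Cutting at c moves the vector from d to d∧c and applies T(d/(d∧c)), while the excesses over the
other c' do not change. The inductive product of defects thus appears between T(d/(d∧c))* and
T(d/(d∧c)), and Nica-covariance moves the latter to its left, forming the defect at c. -/
theorem kernelForm_cutComplement_single (hT : NicaRep T) (L : List (Submonoid.oneLE G))
    (d : Submonoid.oneLE G) (hL : L.Pairwise fun c c' => (exc d c : G) ⊓ (exc d c' : G) = 1)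
    (h k : H) :
    kernelForm (regularKernel T) (Finsupp.single d h) (cutComplement T L (Finsupp.single d k)) =
      ⟪h, (L.map fun c => 1 - adjoint (T (exc d c)) * T (exc d c)).prod k⟫ := by
  induction L generalizing d h k with
  | nil => simp [cutComplement_nil, kernelForm_single_single, inner_regularKernel, exc_of_le]
  | cons c L ih =>
    rw [List.pairwise_cons] at hL
    have h1 : ∀ c' ∈ L, exc (d ⊓ c) c' = exc d c' := fun c' hc' =>
      exc_inf_left_of_disjoint (hL.1 c' hc')
    have h2 : L.Pairwise fun c₁ c₂ => (exc (d ⊓ c) c₁ : G) ⊓ (exc (d ⊓ c) c₂ : G) = 1 :=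
      hL.2.imp_of_mem fun ha hb h => by rwa [h1 _ ha, h1 _ hb]
    have h3 : (L.map fun c' => 1 - adjoint (T (exc (d ⊓ c) c')) * T (exc (d ⊓ c) c')) =
        L.map fun c' => 1 - adjoint (T (exc d c')) * T (exc d c') :=
      List.map_congr_left fun c' hc' => by rw [h1 c' hc']
    have h4 : Commute (T (exc d c))
        (L.map fun c' => 1 - adjoint (T (exc d c')) * T (exc d c')).prod := by
      refine Commute.list_prod_right _ _ fun y hy => ?_
      obtain ⟨c', hc', rfl⟩ := List.mem_map.1 hy
      exact commute_defect hT (hL.1 c' hc')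
    have h5 : kernelForm (regularKernel T) (Finsupp.single d h)
        (cutOff T c (cutComplement T L (Finsupp.single d k))) =
        kernelForm (regularKernel T) (cutOff T c (Finsupp.single d h))
          (cutComplement T L (cutOff T c (Finsupp.single d k))) := by
      rw [← cutOff_cutOff, ← kernelForm_cutOff, ← Module.End.mul_apply (cutOff T c),
        (commute_cutOff_cutComplement T c L).eq, Module.End.mul_apply]
    rw [cutComplement_cons, Module.End.mul_apply, LinearMap.sub_apply, Module.End.one_apply,
      kernelForm_sub_right, h5, cutOff_single, cutOff_single, ih d hL.2, ih (d ⊓ c) h2, h3,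
      List.map_cons, List.prod_cons, ← mul_apply_eq_comp, ← h4.eq, sub_mul, one_mul,
      sub_apply, inner_sub_right, mul_assoc, mul_apply_eq_comp,
      mul_apply_eq_comp, mul_apply_eq_comp,
      adjoint_inner_right]

theorem defect_nonneg {S : H →L[ℂ] H} (hS : ‖S‖ ≤ 1) : 0 ≤ 1 - adjoint S * S := by
  rw [sub_nonneg, ← ContinuousLinearMap.star_eq_adjoint,
    ← CStarAlgebra.norm_le_one_iff_of_nonneg _ (star_mul_self_nonneg S),
    CStarRing.norm_star_mul_self]
  exact mul_le_one₀ hS (norm_nonneg _) hS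

theorem prod_defect_nonneg (hT : NicaRep T) (hc : ∀ p, ‖T p‖ ≤ 1)
    (d : Submonoid.oneLE G) (L : List (Submonoid.oneLE G))
    (hL : L.Pairwise fun c c' => (exc d c : G) ⊓ (exc d c' : G) = 1) :
    0 ≤ (L.map fun c => 1 - adjoint (T (exc d c)) * T (exc d c)).prod := by
  induction L with
  | nil => simp
  | cons c L ih =>
    rw [List.pairwise_cons] at hL
    rw [List.map_cons, List.prod_cons]
    refine Commute.mul_nonneg (defect_nonneg (hc _)) (ih hL.2)
      (Commute.list_prod_right _ _ fun y hy => ?_)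
    obtain ⟨c', hc', rfl⟩ := List.mem_map.1 hy
    have h := commute_defect hT (hL.1 c' hc')
    have h' := h.star_star
    rw [star_sub, star_one, star_mul, ← ContinuousLinearMap.star_eq_adjoint, star_star] at h'
    exact (Commute.one_left _).sub_left (h'.mul_left h)

theorem kernelForm_nonneg_of_supported (hT : NicaRep T) (hc : ∀ p, ‖T p‖ ≤ 1)
    {F : Finset (Submonoid.oneLE G)} (hinf : ∀ a ∈ F, ∀ b ∈ F, a ⊓ b ∈ F)
    (hsup : ∀ a ∈ F, ∀ b ∈ F, a ⊔ b ∈ F) (d : Submonoid.oneLE G) (hd : d ∈ F)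
    (x : Submonoid.oneLE G →₀ H) (hx : x ∈ Finsupp.supported H ℂ {a | a ∈ F ∧ a ≤ d}) :
    0 ≤ (kernelForm (regularKernel T) x x).re := by
  classical
  revert x
  have hwf : WellFounded fun a b : F => a < b := wellFounded_lt
  induction hn : (⟨d, hd⟩ : F) using hwf.induction generalizing d with
  | _ _ ih =>
  subst hn
  intro x hx
  set S := F.filter (· < d) with hS
  -- Only the maximal elements below d are cut: they cover everything below d, and their excesses
  -- are pairwise disjoint.
  set L := (S.filter fun c => Maximal (· ∈ S) c).toList with hLdef
  have hL : ∀ c ∈ L, c ∈ F ∧ c < d := fun c hc => by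
    simpa [hLdef, hS, and_assoc] using (by simpa [hLdef] using hc : c ∈ S ∧ _).1
  refine kernelForm_nonneg_of_cutComplement T hinf L (fun c hc => (hL c hc).1)
    (fun c hc => ih ⟨c, (hL c hc).1⟩ (hL c hc).2 c (hL c hc).1 rfl)
    (Finsupp.supported_mono (fun a ha => ha.1) hx) ?_
  -- Two distinct maximal elements have join d: a join strictly below d would still lie in `S`,
  -- against maximality.
  have hdisj : L.Pairwise fun c c' => (exc d c : G) ⊓ (exc d c' : G) = 1 := by
    refine (Finset.nodup_toList _).imp_of_mem fun {a b} ha hb hab => exc_inf_exc_of_sup_eq ?_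
    have hle : a ⊔ b ≤ d := sup_le (hL a ha).2.le (hL b hb).2.le
    by_contra hne
    have hmem : a ⊔ b ∈ S := by
      simpa [hS] using ⟨hsup _ (hL a ha).1 _ (hL b hb).1, lt_of_le_of_ne hle hne⟩
    have ha' : Maximal (· ∈ S) a := by simp [hLdef] at ha; exact ha.2
    have hb' : Maximal (· ∈ S) b := by simp [hLdef] at hb; exact hb.2
    exact hab ((ha'.eq_of_le hmem le_sup_left).trans (hb'.eq_of_le hmem le_sup_right).symm)
  have hker : cutComplement T L x = cutComplement T L (Finsupp.single d (x d)) := by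
    conv_lhs => rw [← Finsupp.sum_single x, Finsupp.sum, map_sum]
    refine Finset.sum_eq_single d (fun p hp hpd => ?_) (fun h => ?_)
    · have hp' := (Finsupp.mem_supported _ _).1 hx hp
      have hpS : p ∈ S := by simpa [hS] using ⟨hp'.1, lt_of_le_of_ne hp'.2 hpd⟩
      obtain ⟨c, hpc, hcmax⟩ := S.exists_le_maximal hpS
      refine cutComplement_single_of_le T (c := c) ?_ hpc _
      simpa [hLdef] using ⟨hcmax.1, hcmax⟩
    · rw [Finsupp.notMem_support_iff.1 h, Finsupp.single_zero, map_zero]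
  -- The complement is a self-adjoint idempotent, so one of its two occurrences can be absorbed.
  rw [hker, kernelForm_cutComplement, ← Module.End.mul_apply,
    (isIdempotentElem_cutComplement T L).eq, kernelForm_cutComplement_single hT L d hdisj]
  have h := prod_defect_nonneg hT hc d L hdisj
  rw [ContinuousLinearMap.nonneg_iff_isPositive] at h
  exact h.re_inner_nonneg_right _

theorem kernelForm_regularKernel_nonneg (hT : NicaRep T) (hc : ∀ p, ‖T p‖ ≤ 1)
    (x : Submonoid.oneLE G →₀ H) : 0 ≤ (kernelForm (regularKernel T) x x).re := by
  classical
  rcases x.support.eq_empty_or_nonempty with h0 | hne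
  · rw [Finsupp.support_eq_empty.1 h0, kernelForm_zero_left, Complex.zero_re]
  -- The cone is a distributive lattice, so a finite set generates a finite sublattice.
  have hfin := x.support.finite_toSet.latticeClosure
  set F := hfin.toFinset with hF
  have hmem : ∀ a, a ∈ F ↔ a ∈ latticeClosure (x.support : Set (Submonoid.oneLE G)) := by
    simp [hF]
  have hlat := isSublattice_latticeClosure (s := (x.support : Set (Submonoid.oneLE G)))
  have hsub : x.support ⊆ F := fun a ha => (hmem a).2 (subset_latticeClosure ha)
  have hsup : ∀ a ∈ F, ∀ b ∈ F, a ⊔ b ∈ F := fun a ha b hb =>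
    (hmem _).2 (hlat.1 ((hmem a).1 ha) ((hmem b).1 hb))
  have hinf : ∀ a ∈ F, ∀ b ∈ F, a ⊓ b ∈ F := fun a ha b hb =>
    (hmem _).2 (hlat.2 ((hmem a).1 ha) ((hmem b).1 hb))
  have htop : x.support.sup' hne id ∈ F :=
    Finset.sup'_mem (F : Set (Submonoid.oneLE G)) (fun a ha b hb => hsup a ha b hb) _ hne id
      fun a ha => hsub ha
  refine kernelForm_nonneg_of_supported hT hc hinf hsup _ htop x ?_
  rw [Finsupp.mem_supported]
  exact fun a ha => ⟨hsub ha, Finset.le_sup' id ha⟩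

/-- The positive definite kernel of a contractive Nica-covariant representation. -/
def nicaKernel (hT : NicaRep T) (hc : ∀ p, ‖T p‖ ≤ 1) : PosKernel (Submonoid.oneLE G) H where
  ker := regularKernel T
  inner_symm p q h k := by
    rw [inner_regularKernel, regularKernel, mul_apply_eq_comp, adjoint_inner_left]
  nonneg := kernelForm_regularKernel_nonneg hT hc

end Positivity

/-! ### The isometric Nica-covariant dilation. -/

section Dilation

variable {G : Type v} [CommGroup G] [Lattice G] [IsOrderedMonoid G]

local notation "⟪" x ", " y "⟫" => inner ℂ x y

open ContinuousLinearMap (adjoint adjoint_inner_left adjoint_inner_right)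
open PosKernel (weightedMap weightedMap_single)

section IsometricDilation

variable {H : Type*} [NormedAddCommGroup H] [InnerProductSpace ℂ H] [CompleteSpace H]
  {T : Submonoid.oneLE G →* (H →L[ℂ] H)} (hT : NicaRep T) (hc : ∀ p, ‖T p‖ ≤ 1)

theorem inner_nicaKernel_emb (p q : Submonoid.oneLE G) (h k : H) :
    ⟪(nicaKernel hT hc).emb p h, (nicaKernel hT hc).emb q k⟫ =
      ⟪T (exc p q) h, T (exc q p) k⟫ := by
  rw [PosKernel.inner_emb_emb]
  exact inner_regularKernel T p q h k

/-- The translation operators on the Kolmogorov space of a Nica-covariant representation. -/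
def shift (r : Submonoid.oneLE G) : (nicaKernel hT hc).Space →L[ℂ] (nicaKernel hT hc).Space :=
  PosKernel.lift (weightedMap (fun p => r * p) fun _ => 1) 1 fun x => by
    refine PosKernel.norm_of_le_mul zero_le_one (le_of_eq ?_)
    rw [one_pow, one_mul, kernelForm_map_map fun p q v w => ?_]
    rw [weightedMap_single, weightedMap_single, kernelForm_single_single,
      kernelForm_single_single]
    simp only [nicaKernel, inner_regularKernel, exc_mul_mul_left, one_apply_eq_self]

theorem shift_emb (r p : Submonoid.oneLE G) (h : H) :
    shift hT hc r ((nicaKernel hT hc).emb p h) = (nicaKernel hT hc).emb (r * p) h := by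
  rw [PosKernel.emb_apply, shift, PosKernel.lift_of, weightedMap_single]
  rfl

/-- The translation operators form a representation of the positive cone. -/
def shiftHom : Submonoid.oneLE G →*
    ((nicaKernel hT hc).Space →L[ℂ] (nicaKernel hT hc).Space) where
  toFun := shift hT hc
  map_one' := PosKernel.clm_ext fun p h => by rw [shift_emb, one_mul]; rfl
  map_mul' r s := PosKernel.clm_ext fun p h => by
    rw [mul_apply_eq_comp, shift_emb, shift_emb, shift_emb, mul_assoc]

theorem shiftHom_emb (r p : Submonoid.oneLE G) (h : H) :
    shiftHom hT hc r ((nicaKernel hT hc).emb p h) = (nicaKernel hT hc).emb (r * p) h :=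
  shift_emb hT hc r p h

/-- Pairing with the vector at q splits the excess of tq over p as exc t p · exc q (exc p t). To
move T(exc t p) to the other side, its adjoint must pass T(exc (exc p t) q); the two elements are
disjoint, so Nica-covariance applies. -/
theorem adjoint_shiftHom_emb (t p : Submonoid.oneLE G) (h : H) :
    adjoint (shiftHom hT hc t) ((nicaKernel hT hc).emb p h) =
      (nicaKernel hT hc).emb (exc p t) (adjoint (T (exc t p)) h) := by
  refine PosKernel.ext_inner_emb fun q k => ?_
  have h1 : Commute (T (exc (exc p t) q)) (adjoint (T (exc t p))) := hT _ _ (exc_exc_inf p t q)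
  rw [adjoint_inner_left, shiftHom_emb, inner_nicaKernel_emb, inner_nicaKernel_emb,
    exc_mul_right, exc_mul_left, map_mul, ← mul_apply_eq_comp (T (exc (exc p t) q)), h1.eq,
    mul_apply_eq_comp, mul_apply_eq_comp, adjoint_inner_left]

theorem nicaRep_shiftHom : NicaRep (shiftHom hT hc) := fun s t hst =>
  PosKernel.clm_ext fun p h => by
    rw [mul_apply_eq_comp, mul_apply_eq_comp, shiftHom_emb, adjoint_shiftHom_emb,
      adjoint_shiftHom_emb, shiftHom_emb, exc_mul_of_disjoint hst, exc_mul_of_disjoint' hst]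

theorem norm_shiftHom_apply (r : Submonoid.oneLE G) (x : (nicaKernel hT hc).Space) :
    ‖shiftHom hT hc r x‖ = ‖x‖ := by
  refine (ContinuousLinearMap.norm_map_iff_adjoint_comp_self (shiftHom hT hc r)).2 ?_ x
  refine PosKernel.clm_ext fun p h => PosKernel.ext_inner_emb fun q k => ?_
  rw [ContinuousLinearMap.comp_apply, adjoint_inner_left, shiftHom_emb, shiftHom_emb,
    inner_nicaKernel_emb, exc_mul_mul_left, exc_mul_mul_left, ← inner_nicaKernel_emb hT hc]
  rfl

theorem norm_emb_one (h : H) : ‖(nicaKernel hT hc).emb 1 h‖ = ‖h‖ := by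
  refine (sq_eq_sq₀ (norm_nonneg _) (norm_nonneg _)).1 ?_
  rw [← inner_self_eq_norm_sq (𝕜 := ℂ), ← inner_self_eq_norm_sq (𝕜 := ℂ), inner_nicaKernel_emb,
    exc_one_left, map_one]
  rfl

end IsometricDilation

/-! ### The dilated representation of A, and compression to H. -/

section Representation

variable {A : Type u} [NonUnitalCStarAlgebra A] {α : Submonoid.oneLE G →* (A →⋆ₙₐ[ℂ] A)}
  (X : CovariantPair.{u, v, w} α)

theorem CovariantPair.covariant_adjoint (s : Submonoid.oneLE G) (a : A) :
    adjoint (X.T s) * X.π a = X.π (α s a) * adjoint (X.T s) := by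
  have h := congrArg star (X.covariant s (star a))
  rwa [star_mul, star_mul, ← map_star X.π, ← map_star X.π, ← map_star (α s), star_star,
    ContinuousLinearMap.star_eq_adjoint] at h

/-- Both α_p and α_q factor through α_{p∧q}. Covariance and its adjoint strip off the two excess
endomorphisms, leaving π(α_{p∧q}(a)) between the two factors of the kernel. -/
theorem regularKernel_intertwine (p q : Submonoid.oneLE G) (a : A) :
    X.π (α p a) * regularKernel X.T p q = regularKernel X.T p q * X.π (α q a) := by
  have h1 : α p = α (exc p q) * α (p ⊓ q) := by rw [← map_mul, exc_mul_inf]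
  have h2 : α q = α (exc q p) * α (p ⊓ q) := by rw [← map_mul, inf_comm, exc_mul_inf]
  have h1' : α p a = α (exc p q) (α (p ⊓ q) a) := DFunLike.congr_fun h1 a
  have h2' : α q a = α (exc q p) (α (p ⊓ q) a) := DFunLike.congr_fun h2 a
  rw [regularKernel, ← mul_assoc, h1', h2', ← X.covariant_adjoint, mul_assoc, X.covariant,
    mul_assoc]

/-- The unital extension of the representation `π ∘ α_p`. -/
def unitalRep (p : Submonoid.oneLE G) : Unitization ℂ A →⋆ₐ[ℂ] (X.H →L[ℂ] X.H) :=
  Unitization.starLift (X.π.comp (α p))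

theorem unitalRep_inr (p : Submonoid.oneLE G) (a : A) :
    unitalRep X p (Unitization.inr a) = X.π (α p a) := by
  rw [unitalRep, ← Unitization.starLift_symm_apply_apply, Equiv.symm_apply_apply]
  rfl

theorem unitalRep_intertwine (p q : Submonoid.oneLE G) (u : Unitization ℂ A) :
    unitalRep X p u * regularKernel X.T p q = regularKernel X.T p q * unitalRep X q u := by
  induction u using Unitization.ind with
  | inl_add_inr c a =>
    have h : (Unitization.inl c : Unitization ℂ A) = algebraMap ℂ _ c := rfl
    rw [map_add, map_add, add_mul, mul_add, unitalRep_inr, unitalRep_inr,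
      regularKernel_intertwine, h, AlgHomClass.commutes, AlgHomClass.commutes,
      Algebra.commutes]

/-- The diagonal action of the unitization of `A` on `P →₀ H`. -/
def diagAction (u : Unitization ℂ A) : Module.End ℂ (Submonoid.oneLE G →₀ X.H) :=
  weightedMap id fun p => unitalRep X p u

theorem diagAction_single (u : Unitization ℂ A) (p : Submonoid.oneLE G) (h : X.H) :
    diagAction X u (Finsupp.single p h) = Finsupp.single p (unitalRep X p u h) :=
  weightedMap_single _ _ _ _

theorem diagAction_mul (u v : Unitization ℂ A) :
    diagAction X (u * v) = diagAction X u * diagAction X v :=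
  Finsupp.lhom_ext fun p h => by
    rw [Module.End.mul_apply, diagAction_single, diagAction_single, diagAction_single, map_mul]
    rfl

theorem diagAction_add (u v : Unitization ℂ A) :
    diagAction X (u + v) = diagAction X u + diagAction X v :=
  Finsupp.lhom_ext fun p h => by
    rw [LinearMap.add_apply, diagAction_single, diagAction_single, diagAction_single, map_add,
      add_apply, Finsupp.single_add]

theorem diagAction_algebraMap (c : ℂ) :
    diagAction X (algebraMap ℂ _ c) = c • 1 :=
  Finsupp.lhom_ext fun p h => by
    rw [diagAction_single, AlgHomClass.commutes, LinearMap.smul_apply, Module.End.one_apply,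
      Finsupp.smul_single, Algebra.algebraMap_eq_smul_one]
    rfl

theorem kernelForm_diagAction (u : Unitization ℂ A) (x y : Submonoid.oneLE G →₀ X.H) :
    kernelForm (regularKernel X.T) (diagAction X u x) y =
      kernelForm (regularKernel X.T) x (diagAction X (star u) y) := by
  refine kernelForm_map_eq (fun p q h k => ?_) x y
  rw [diagAction_single, diagAction_single, kernelForm_single_single, kernelForm_single_single,
    ← mul_apply_eq_comp (regularKernel X.T p q), ← unitalRep_intertwine, map_star,
    ContinuousLinearMap.star_eq_adjoint, mul_apply_eq_comp, adjoint_inner_right]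

variable {X}

/-- In the unitization ‖u‖²·1 − u*u = b*b for some b. The gap between the two sides is therefore the
form at b acting on x, which is nonnegative. -/
theorem kernelForm_diagAction_le (hX : NicaRep X.T) (u : Unitization ℂ A)
    (x : Submonoid.oneLE G →₀ X.H) :
    (kernelForm (regularKernel X.T) (diagAction X u x) (diagAction X u x)).re ≤
      ‖u‖ ^ 2 * (kernelForm (regularKernel X.T) x x).re := by
  let _ := CStarAlgebra.spectralOrder (Unitization ℂ A)
  have _ := CStarAlgebra.spectralOrderedRing (Unitization ℂ A)
  have h := CStarAlgebra.star_mul_le_algebraMap_norm_sq (a := u)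
  rw [← sub_nonneg, CStarAlgebra.nonneg_iff_eq_star_mul_self] at h
  obtain ⟨b, hb⟩ := h
  have hsum : algebraMap ℂ (Unitization ℂ A) ((‖u‖ ^ 2 : ℝ) : ℂ) = star b * b + star u * u := by
    rw [← hb, sub_add_cancel]
    exact (IsScalarTower.algebraMap_apply ℝ ℂ (Unitization ℂ A) _).symm
  have key : ((‖u‖ ^ 2 : ℝ) : ℂ) * kernelForm (regularKernel X.T) x x =
      kernelForm (regularKernel X.T) (diagAction X b x) (diagAction X b x) +
        kernelForm (regularKernel X.T) (diagAction X u x) (diagAction X u x) := by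
    rw [kernelForm_diagAction, kernelForm_diagAction, ← Module.End.mul_apply,
      ← Module.End.mul_apply, ← diagAction_mul, ← diagAction_mul, ← kernelForm_add_right,
      ← LinearMap.add_apply, ← diagAction_add, ← hsum, diagAction_algebraMap,
      LinearMap.smul_apply, kernelForm_smul_right, Module.End.one_apply]
  have hre := congrArg Complex.re key
  rw [Complex.re_ofReal_mul, Complex.add_re] at hre
  have := kernelForm_regularKernel_nonneg hX X.contractive (diagAction X b x)
  linarith

/-- The kernel of a Nica-covariant pair. -/
abbrev pairKernel (hX : NicaRep X.T) : PosKernel (Submonoid.oneLE G) X.H :=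
  nicaKernel hX X.contractive

/-- The operators of the dilated representation of `A`. -/
def dilRep (hX : NicaRep X.T) (a : A) : (pairKernel hX).Space →L[ℂ] (pairKernel hX).Space :=
  PosKernel.lift (diagAction X (Unitization.inr a)) ‖(Unitization.inr a : Unitization ℂ A)‖
    fun x => PosKernel.norm_of_le_mul (norm_nonneg _) (kernelForm_diagAction_le hX _ x)

theorem dilRep_emb (hX : NicaRep X.T) (a : A) (p : Submonoid.oneLE G) (h : X.H) :
    dilRep hX a ((pairKernel hX).emb p h) = (pairKernel hX).emb p (X.π (α p a) h) := by
  rw [PosKernel.emb_apply, dilRep, PosKernel.lift_of, diagAction_single, unitalRep_inr]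
  rfl

/-- The dilated representation of `A`. -/
def dilRepHom (hX : NicaRep X.T) :
    A →⋆ₙₐ[ℂ] ((pairKernel hX).Space →L[ℂ] (pairKernel hX).Space) where
  toFun := dilRep hX
  map_smul' c a := PosKernel.clm_ext fun p h => by
    rw [dilRep_emb, map_smul, map_smul]
    simp only [MonoidHom.id_apply, smul_apply, map_smul, dilRep_emb]
  map_zero' := PosKernel.clm_ext fun p h => by
    rw [dilRep_emb, map_zero, map_zero, zero_apply, map_zero, zero_apply]
  map_add' a b := PosKernel.clm_ext fun p h => by
    rw [dilRep_emb, map_add, map_add, add_apply, map_add, add_apply, dilRep_emb, dilRep_emb]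
  map_mul' a b := PosKernel.clm_ext fun p h => by
    rw [dilRep_emb, map_mul, map_mul, mul_apply_eq_comp, mul_apply_eq_comp, dilRep_emb,
      dilRep_emb]
  map_star' a := PosKernel.clm_ext fun p h => PosKernel.ext_inner_emb fun q k => by
    rw [dilRep_emb, ContinuousLinearMap.star_eq_adjoint, adjoint_inner_left, dilRep_emb,
      PosKernel.inner_emb_emb, PosKernel.inner_emb_emb, map_star, map_star,
      ContinuousLinearMap.star_eq_adjoint, adjoint_inner_left]
    change ⟪h, (X.π (α p a) * regularKernel X.T p q) k⟫ = _
    rw [regularKernel_intertwine]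
    rfl

/-- The isometric dilation of a Nica-covariant pair. -/
def isoDilation (hX : NicaRep X.T) : CovariantPair.{u, v, w} α where
  H := (pairKernel hX).Space
  π := dilRepHom hX
  T := shiftHom hX X.contractive
  contractive p := ContinuousLinearMap.opNorm_le_bound _ zero_le_one fun x => by
    rw [norm_shiftHom_apply, one_mul]
  covariant s a := PosKernel.clm_ext fun p h => by
    -- Commutativity of the cone enters here: α is a homomorphism, so α_{sp} is a priori α_s ∘ α_p.
    have hα : α (s * p) a = α p (α s a) := by
      rw [mul_comm, map_mul]
      rfl
    change dilRep hX a (shiftHom _ _ s _) = shiftHom _ _ s (dilRep hX (α s a) _)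
    rw [shiftHom_emb, dilRep_emb, dilRep_emb, shiftHom_emb, hα]

theorem isoDilation_mem_ncIso (hX : NicaRep X.T) : isoDilation hX ∈ ncIso.{u, v, w} α :=
  ⟨nicaRep_shiftHom hX X.contractive, fun s =>
    AddMonoidHomClass.isometry_of_norm _ (norm_shiftHom_apply hX X.contractive s)⟩

/-- The dilated monomial sends the vector k at e to π(a)k at p. Pairing with h at e applies T(p),
since the excess of p over e is p and that of e over p is e. -/
theorem inner_eval_isoDilation (hX : NicaRep X.T) (f : Poly α) (h k : X.H) :
    ⟪(pairKernel hX).emb 1 h, (isoDilation hX).eval f ((pairKernel hX).emb 1 k)⟫ =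
      ⟪h, X.eval f k⟫ := by
  let l : Poly α →+ ℂ :=
    { toFun := fun f =>
        ⟪(pairKernel hX).emb 1 h, (isoDilation hX).eval f ((pairKernel hX).emb 1 k)⟫
      map_zero' := by rw [CovariantPair.eval_zero]; exact inner_zero_right _
      map_add' := fun f g => by rw [CovariantPair.eval_add]; exact inner_add_right _ _ _ }
  let r : Poly α →+ ℂ :=
    { toFun := fun f => ⟪h, X.eval f k⟫
      map_zero' := by rw [CovariantPair.eval_zero]; exact inner_zero_right _
      map_add' := fun f g => by rw [CovariantPair.eval_add]; exact inner_add_right _ _ _ }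
  have hlr : l = r := Poly.addHom_ext fun p a => by
    change ⟪(pairKernel hX).emb 1 h, (isoDilation hX).eval (Poly.monomial α p a)
      ((pairKernel hX).emb 1 k)⟫ = ⟪h, X.eval (Poly.monomial α p a) k⟫
    rw [CovariantPair.eval_monomial, CovariantPair.eval_monomial]
    change ⟪(pairKernel hX).emb 1 h, shiftHom hX X.contractive p
      (dilRep hX a ((pairKernel hX).emb 1 k))⟫ = ⟪h, X.T p (X.π a k)⟫
    rw [dilRep_emb, shiftHom_emb, inner_nicaKernel_emb, exc_one_left, mul_one, exc_one_right,
      map_one, map_one]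
    rfl
  exact DFunLike.congr_fun hlr f

theorem norm_eval_le_isoDilation (hX : NicaRep X.T) (f : Poly α) :
    ‖X.eval f‖ ≤ ‖(isoDilation hX).eval f‖ := by
  refine ContinuousLinearMap.opNorm_le_of_re_inner_le (norm_nonneg _) fun k h hk hh => ?_
  rw [inner_re_symm, ← inner_eval_isoDilation hX]
  refine (re_inner_le_norm (𝕜 := ℂ) _ _).trans ?_
  have h1 := ((isoDilation hX).eval f).le_opNorm ((pairKernel hX).emb 1 k)
  have hk' : ‖(pairKernel hX).emb 1 k‖ = 1 := (norm_emb_one hX X.contractive k).trans hk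
  have hh' : ‖(pairKernel hX).emb 1 h‖ = 1 := (norm_emb_one hX X.contractive h).trans hh
  rw [hh', one_mul]
  exact h1.trans_eq ((congrArg _ hk').trans (mul_one _))

end Representation

end Dilation

/-! ### From equal seminorms to isomorphic completions. -/

section Completion

variable {P : Type v} [CommMonoid P] {A : Type u} [NonUnitalCStarAlgebra A]
  {α : P →* (A →⋆ₙₐ[ℂ] A)} {𝓕 𝓖 : Set (CovariantPair.{u, v, w} α)}

/-- Equal seminorms on polynomials give a linear isometry of the semicrossed products that fixes
the polynomials. -/
theorem exists_isometry_of_familyNorm_eq (h : ∀ q, familyNorm 𝓕 q = familyNorm 𝓖 q) :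
    ∃ Ψ : SemicrossedProduct 𝓕 →ₗᵢ[ℂ] SemicrossedProduct 𝓖,
      ∀ q, Ψ (SemicrossedProduct.ofPoly 𝓕 q) = SemicrossedProduct.ofPoly 𝓖 q := by
  let f : NormedPoly 𝓕 →L[ℂ] NormedPoly 𝓖 :=
    (show NormedPoly 𝓕 →ₗ[ℂ] NormedPoly 𝓖 from (LinearMap.id : Poly α →ₗ[ℂ] Poly α)).mkContinuous
      1 fun q => by rw [one_mul]; exact (h q).ge
  let g : SemicrossedProduct 𝓕 →L[ℂ] SemicrossedProduct 𝓖 := f.completion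
  have hg : ∀ q, g (SemicrossedProduct.ofPoly 𝓕 q) = SemicrossedProduct.ofPoly 𝓖 q :=
    fun q => ContinuousLinearMap.completion_apply_coe f q
  refine ⟨⟨g, fun x => ?_⟩, hg⟩
  refine SemicrossedProduct.ind (p := fun x => ‖g x‖ = ‖x‖) x
    (isClosed_eq g.continuous.norm continuous_norm) fun q => ?_
  rw [hg, SemicrossedProduct.norm_ofPoly, SemicrossedProduct.norm_ofPoly, h]

/-- The isometric image of a complete space is closed, and here it contains the dense image of the
polynomials; multiplicativity extends from polynomials by continuity. -/
theorem exists_equiv_of_familyNorm_eq (h : ∀ q, familyNorm 𝓕 q = familyNorm 𝓖 q) :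
    ∃ Φ : SemicrossedProduct 𝓕 ≃ₗᵢ[ℂ] SemicrossedProduct 𝓖,
      (∀ x y, Φ (x * y) = Φ x * Φ y) ∧
      ∀ q, Φ (SemicrossedProduct.ofPoly 𝓕 q) = SemicrossedProduct.ofPoly 𝓖 q := by
  obtain ⟨Ψ, hΨ⟩ := exists_isometry_of_familyNorm_eq h
  have hdense : DenseRange Ψ := (SemicrossedProduct.denseRange_ofPoly 𝓖).mono (by
    rintro _ ⟨q, rfl⟩
    exact ⟨_, hΨ q⟩)
  have hsurj : Function.Surjective Ψ := by
    rw [← Set.range_eq_univ, ← hdense.closure_range]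
    exact (Ψ.isometry.isClosedEmbedding.isClosed_range.closure_eq).symm
  refine ⟨LinearIsometryEquiv.ofSurjective Ψ hsurj, fun x y => ?_, hΨ⟩
  change Ψ (x * y) = Ψ x * Ψ y
  refine SemicrossedProduct.ind x (isClosed_eq
    (Ψ.continuous.comp (continuous_id.mul continuous_const))
    (Ψ.continuous.mul continuous_const)) fun f => ?_
  refine SemicrossedProduct.ind y (isClosed_eq
    (Ψ.continuous.comp (continuous_const.mul continuous_id))
    (continuous_const.mul Ψ.continuous)) fun g => ?_
  rw [← SemicrossedProduct.ofPoly_mul, hΨ, hΨ, hΨ, SemicrossedProduct.ofPoly_mul]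

end Completion

theorem familyNorm_nc_eq_familyNorm_ncIso {G : Type v} [CommGroup G] [Lattice G]
    [IsOrderedMonoid G] {A : Type u} [NonUnitalCStarAlgebra A]
    (α : Submonoid.oneLE G →* (A →⋆ₙₐ[ℂ] A)) (q : Poly α) :
    familyNorm (nc.{u, v, w} α) q = familyNorm (ncIso.{u, v, w} α) q :=
  le_antisymm
    (familyNorm_le _ (familyNorm_nonneg _ _) fun _ hX =>
      (norm_eval_le_isoDilation hX q).trans
        (le_familyNorm (ncIso α) ⟨_, isoDilation_mem_ncIso hX⟩ q))
    (familyNorm_le _ (familyNorm_nonneg _ _) fun X hX => le_familyNorm (nc α) ⟨X, hX.1⟩ q)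

end Semicrossed

end

theorem mainTheorem8 {G : Type v} [CommGroup G] [Lattice G] [IsOrderedMonoid G]
    {A : Type u} [NonUnitalCStarAlgebra A] (α : Submonoid.oneLE G →* (A →⋆ₙₐ[ℂ] A)) :
    ∃ Φ : Semicrossed.SemicrossedProduct (Semicrossed.nc.{u, v, w} α) ≃ₗᵢ[ℂ]
        Semicrossed.SemicrossedProduct (Semicrossed.ncIso.{u, v, w} α),
      (∀ x y, Φ (x * y) = Φ x * Φ y) ∧
      ∀ q : Semicrossed.Poly α,
        Φ (Semicrossed.SemicrossedProduct.ofPoly (Semicrossed.nc.{u, v, w} α) q) =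
          Semicrossed.SemicrossedProduct.ofPoly (Semicrossed.ncIso.{u, v, w} α) q := by
  exact Semicrossed.exists_equiv_of_familyNorm_eq
    (Semicrossed.familyNorm_nc_eq_familyNorm_ncIso α)
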